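/- Write $[k]=\{1,\dots,k\}$. For a finite family $\mathcal F$ of sets, let $\nu(\mathcal F)$ be the maximum number of pairwise disjoint distinct members of $\mathcal F$. A family $\mathcal F\subset 2^{[n]}$ is \emph{shifted} if, whenever $\{a_1<\dots<a_k\}\in\mathcal F$ and $\{b_1<\dots<b_k\}\subset[n]$ satisfies $b_i\le a_i$ for all $i$, also $\{b_1,\dots,b_k\}\in\mathcal F$. For integers $m\ge 2$ and $1\le c\le s$ put $n=ms+c$, $\ell=s-c$, and \[ \mathcal Q(m,s,\ell)=\{P\subset[n]: |P|+|P\cap[ms-c-1]|\ge 2m\},\qquad \mathcal W(m,s,\ell)=\{P\subset[n]: |P\cap[ms-1]|\ge m\}. \] For a family $\mathcal F\subset 2^{[n]}$ let $\overline{\mathcal F}=2^{[n]}\setminus\mathcal F$. \textbf{Theorem.} Fix integers $m\ge 2$ and $c\ge 1$. There is a constant $K$, depending only on $m$ and $c$, such that for all $s\ge c$ the following hold with $n=ms+c$ and $\ell=s-c$. (1) Let $\mathcal F\subset 2^{[n]}$ be a shifted family with $\nu(\mathcal F)<s$. Suppose that $\mathcal F\nsubseteq\mathcal Q(m,s,\ell)$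 and, in case $c=1$, also $\mathcal F\nsubseteq\mathcal W(m,s,\ell)$. Then \[ |\overline{\mathcal F}|\ \ge\ (2c+3)\binom{n}{m-1}-K s^{m-2}. \] (2) One has \[ \left|\,|\overline{\mathcal Q(m,s,\ell)}|-(2c+2)\binom{n}{m-1}\right|\ \le\ K s^{m-2}. \] -/

import Mathlib

/-- The matching number `ν(F)`: the largest number of sets in a subfamily of `F` whose members
are pairwise disjoint. -/
def matchingNumber (F : Finset (Finset ℕ)) : ℕ :=
  (F.powerset.filter (fun M => ∀ A ∈ M, ∀ B ∈ M, A ≠ B → Disjoint A B)).sup Finset.card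

/-- `A = {a₁ < ⋯ < aₖ}` can be shifted to `B = {b₁ < ⋯ < bₖ}`: the two sets have the same size and
`bᵢ ≤ aᵢ` for every `i`. -/
def CanShift (A B : Finset ℕ) : Prop :=
  ∃ h : B.card = A.card, ∀ i : Fin A.card, B.orderEmbOfFin h i ≤ A.orderEmbOfFin rfl i

/-- A family `F` of subsets of `[n] = {1, …, n}` is shifted if it contains, with each of its
members `A`, every `B ⊆ [n]` to which `A` can be shifted. -/
def IsShifted (n : ℕ) (F : Finset (Finset ℕ)) : Prop :=
  ∀ A ∈ F, ∀ B ⊆ Finset.Icc 1 n, CanShift A B → B ∈ F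

/-- The complement `2^[n] \ F`: the subsets of `[n]` missing from `F`. -/
def missingSets (n : ℕ) (F : Finset (Finset ℕ)) : Finset (Finset ℕ) :=
  (Finset.Icc 1 n).powerset \ F

/-- The family `Q(m, s, ℓ)`, `ℓ = s - c`, on the ground set `[n]`, `n = ms + c`:
the sets `P ⊆ [n]` with `|P| + |P ∩ [ms - c - 1]| ≥ 2m`. -/
def familyQ (m s c : ℕ) : Finset (Finset ℕ) :=
  (Finset.Icc 1 (m * s + c)).powerset.filter
    (fun P => 2 * m ≤ P.card + (P ∩ Finset.Icc 1 (m * s - c - 1)).card)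

/-- The family `W(m, s, ℓ)`, `ℓ = s - c`, on the ground set `[n]`, `n = ms + c`:
the sets `P ⊆ [n]` with `|P ∩ [ms - 1]| ≥ m`. -/
def familyW (m s c : ℕ) : Finset (Finset ℕ) :=
  (Finset.Icc 1 (m * s + c)).powerset.filter
    (fun P => m ≤ (P ∩ Finset.Icc 1 (m * s - 1)).card)

/-
Let `G` be the closure of `F` under adding elements and decreasing them; this creates at most one
new missing set (the empty one) and no larger matching. Split `[n]` into a head `[h]` and a tail of
bounded size, and call a subset `J` of the tail rich if `A ∪ J ∈ G` for plenty of
`(m - 1)`-subsets `A` of the head. A poor `J` costs about `C(n, m - 1)` missing sets, so it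
suffices to find `2c + 3` poor sets. Unless there are so many missing sets anyway, every large
subset of the head splits into members of `G` of size `m`, and a matching of `r` rich sets extends
to `r` disjoint members of `G` that save one element of the head each. If there are at most
`2c + 2` poor sets, then `ν(F) < s` forces the rich sets to look like those of `Q`, or like those
of `W` when `c = 1`. Either way the complement of a member of `F` outside `Q` (resp. `W`) contains
`s - 1` disjoint members of `G`, contradicting `ν(F) < s`.
-/

section

open Finset Function

section Matchings

variable {α : Type*} {𝒢 ℱ : Finset (Finset α)} {A U V : Finset α} {r r' : ℕ}

/-- `V` contains `r` pairwise disjoint members of `𝒢`. The members are indexed, so the empty set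
may occur more than once. -/
def ContainsMatching (𝒢 : Finset (Finset α)) (V : Finset α) (r : ℕ) : Prop :=
  ∃ g : Fin r → Finset α, (∀ i, g i ∈ 𝒢 ∧ g i ⊆ V) ∧ Pairwise (Disjoint on g)

namespace ContainsMatching

theorem zero (𝒢 : Finset (Finset α)) (V : Finset α) : ContainsMatching 𝒢 V 0 :=
  ⟨Fin.elim0, fun i => i.elim0, fun i => i.elim0⟩

theorem mono (hUV : U ⊆ V) : ContainsMatching 𝒢 U r → ContainsMatching 𝒢 V r := by
  rintro ⟨g, hg, hdisj⟩
  exact ⟨g, fun i => ⟨(hg i).1, (hg i).2.trans hUV⟩, hdisj⟩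

theorem of_forall_exists_subset (h : ∀ A ∈ 𝒢, ∃ B ∈ ℱ, B ⊆ A) :
    ContainsMatching 𝒢 V r → ContainsMatching ℱ V r := by
  rintro ⟨g, hg, hdisj⟩
  choose f hfℱ hfg using fun i => h (g i) (hg i).1
  exact ⟨f, fun i => ⟨hfℱ i, (hfg i).trans (hg i).2⟩,
    fun i j hij => (hdisj hij).mono (hfg i) (hfg j)⟩

section DecidableEq

variable [DecidableEq α]

theorem exists_of_succ :
    ContainsMatching 𝒢 V (r + 1) → ∃ A ∈ 𝒢, A ⊆ V ∧ ContainsMatching 𝒢 (V \ A) r := by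
  rintro ⟨g, hg, hdisj⟩
  refine ⟨g 0, (hg 0).1, (hg 0).2, fun i => g i.succ, fun i => ⟨(hg i.succ).1, ?_⟩,
    hdisj.comp_of_injective (Fin.succ_injective r)⟩
  exact subset_sdiff.2 ⟨(hg i.succ).2, hdisj (Fin.succ_ne_zero i)⟩

theorem cons (hA : A ∈ 𝒢) (hAV : A ⊆ V) :
    ContainsMatching 𝒢 (V \ A) r → ContainsMatching 𝒢 V (r + 1) := by
  rintro ⟨g, hg, hdisj⟩
  have hAg : ∀ i, Disjoint A (g i) := fun i => disjoint_sdiff.mono_right (hg i).2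
  refine ⟨Fin.cons A g,
    Fin.cases ⟨hA, hAV⟩ fun i => ⟨(hg i).1, (hg i).2.trans sdiff_subset⟩, ?_⟩
  intro i j hij
  cases i using Fin.cases <;> cases j using Fin.cases
  case zero.zero => exact absurd rfl hij
  case zero.succ j => exact hAg j
  case succ.zero i => exact (hAg i).symm
  case succ.succ i j => exact hdisj (by simpa only [ne_eq, Fin.succ_inj] using hij)

theorem union (hUV : Disjoint U V) (hU : ContainsMatching 𝒢 U r) (hV : ContainsMatching 𝒢 V r') :
    ContainsMatching 𝒢 (U ∪ V) (r + r') := by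
  induction r generalizing U with
  | zero => simpa only [zero_add] using hV.mono subset_union_right
  | succ r ih =>
    obtain ⟨A, hA, hAU, hUA⟩ := hU.exists_of_succ
    rw [Nat.add_right_comm]
    refine cons hA (hAU.trans subset_union_left) ((ih (hUV.mono_left sdiff_subset) hUA).mono ?_)
    rw [union_sdiff_distrib, sdiff_eq_self_of_disjoint (hUV.mono_left hAU).symm]

theorem of_insert {b : ℕ} (hUV : Disjoint U V)
    (h : ∀ A ∈ U.powersetCard b, ∀ v ∈ V, insert v A ∈ 𝒢) (hU : b * r ≤ #U) (hV : r ≤ #V) :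
    ContainsMatching 𝒢 (U ∪ V) r := by
  induction r generalizing U V with
  | zero => exact zero 𝒢 _
  | succ r ih =>
    rw [Nat.mul_succ] at hU
    obtain ⟨A, hA⟩ := powersetCard_nonempty_of_le (s := U) (n := b) (by lia)
    obtain ⟨v, hv⟩ := card_pos.1 (r.succ_pos.trans_le hV)
    obtain ⟨hAU, hAb⟩ := mem_powersetCard.1 hA
    have hrest : ContainsMatching 𝒢 (U \ A ∪ V.erase v) r := by
      refine ih (hUV.mono sdiff_subset (erase_subset v V))
        (fun B hB w hw => h B (powersetCard_mono sdiff_subset hB) w (mem_of_mem_erase hw)) ?_ ?_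
      · rw [card_sdiff_of_subset hAU]
        lia
      · rw [card_erase_of_mem hv]
        lia
    refine cons (h A hA v hv)
      (insert_subset (mem_union_right U hv) (hAU.trans subset_union_left)) (hrest.mono ?_)
    rw [insert_eq, union_sdiff_distrib, sdiff_union_distrib, sdiff_union_distrib,
      sdiff_eq_self_of_disjoint (hUV.mono_right (singleton_subset_iff.2 hv)),
      sdiff_eq_self_of_disjoint (hUV.mono_left hAU).symm, sdiff_singleton_eq_erase,
      inter_eq_right.2 sdiff_subset, inter_eq_left.2 (erase_subset v V)]

end DecidableEq

theorem of_powersetCard {b : ℕ} (h : ∀ A ∈ V.powersetCard b, A ∈ 𝒢) (hr : b * r ≤ #V) :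
    ContainsMatching 𝒢 V r := by
  classical
  induction r generalizing V with
  | zero => exact zero 𝒢 V
  | succ r ih =>
    rw [Nat.mul_succ] at hr
    obtain ⟨A, hA⟩ := powersetCard_nonempty_of_le (s := V) (n := b) (by lia)
    obtain ⟨hAV, hAb⟩ := mem_powersetCard.1 hA
    refine cons (h A hA) hAV (ih (fun B hB => h B (powersetCard_mono sdiff_subset hB)) ?_)
    rw [card_sdiff_of_subset hAV]
    lia

theorem of_singletons (h : ∀ x ∈ V, {x} ∈ 𝒢) (hr : r ≤ #V) : ContainsMatching 𝒢 V r := by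
  refine of_powersetCard (b := 1) (fun A hA => ?_) (by rwa [one_mul])
  obtain ⟨hAV, hA1⟩ := mem_powersetCard.1 hA
  obtain ⟨x, rfl⟩ := card_eq_one.1 hA1
  exact h x (singleton_subset_iff.1 hAV)

end ContainsMatching

theorem card_le_matchingNumber {F M : Finset (Finset ℕ)} (hMF : M ⊆ F)
    (hM : (M : Set (Finset ℕ)).PairwiseDisjoint id) : #M ≤ matchingNumber F :=
  le_sup (f := card) (mem_filter.2 ⟨mem_powerset.2 hMF, hM⟩)

theorem ContainsMatching.lt_matchingNumber {F : Finset (Finset ℕ)} {D V : Finset ℕ} {r : ℕ}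
    (hD : D ∈ F) (hDV : Disjoint D V) :
    ContainsMatching {A ∈ F | A.Nonempty} V r → r < matchingNumber F := by
  rintro ⟨g, hg, hdisj⟩
  simp only [mem_filter] at hg
  have hinj : Injective g := fun i j hij => by
    by_contra hne
    have := hdisj hne
    rw [onFun, hij, disjoint_self_iff_empty] at this
    exact (hg j).1.2.ne_empty this
  have hDg : ∀ i, Disjoint D (g i) := fun i => hDV.mono_right (hg i).2
  have hDM : D ∉ univ.image g := by
    intro h
    obtain ⟨i, -, rfl⟩ := mem_image.1 h
    exact (hg i).1.2.ne_empty (disjoint_self_iff_empty _ |>.1 (hDg i))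
  have hM := card_le_matchingNumber (F := F) (M := insert D (univ.image g))
    (insert_subset hD (image_subset_iff.2 fun i _ => (hg i).1.1)) (by
      rw [coe_insert, coe_image, coe_univ, Set.image_univ]
      refine (hdisj.range_pairwise (r := Disjoint)).insert ?_
      rintro _ ⟨i, rfl⟩ -
      exact ⟨hDg i, (hDg i).symm⟩)
  rwa [card_insert_of_notMem hDM, card_image_of_injective _ hinj, card_univ, Fintype.card_fin] at hM

theorem ContainsMatching.le_matchingNumber {F : Finset (Finset ℕ)} {V : Finset ℕ} {r : ℕ}
    (h : ContainsMatching {A ∈ F | A.Nonempty} V r) : r ≤ matchingNumber F := by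
  cases r with
  | zero => exact Nat.zero_le _
  | succ r =>
    obtain ⟨A, hA, -, hV⟩ := h.exists_of_succ
    exact hV.lt_matchingNumber (mem_filter.1 hA).1 disjoint_sdiff

end Matchings

section Domination

variable {α : Type*} [Preorder α] {X X' Y Y' : Finset α}

/-- Some injection `X → Y` increases no element. For sets of the same size this says that `X` can
be shifted to `Y`, but `Y` may also be larger. -/
def Dominates (X Y : Finset α) : Prop :=
  ∃ f : α → α, Set.InjOn f X ∧ ∀ x ∈ X, f x ∈ Y ∧ f x ≤ x

namespace Dominates

theorem of_subset (h : X ⊆ Y) : Dominates X Y :=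
  ⟨id, Set.injOn_id _, fun _ hx => ⟨h hx, le_rfl⟩⟩

theorem of_forall_le (hcard : #X = #Y) (h : ∀ x ∈ X, ∀ y ∈ Y, y ≤ x) : Dominates X Y := by
  classical
  rcases Y.eq_empty_or_nonempty with rfl | ⟨y, -⟩
  · exact of_subset (card_eq_zero.1 hcard).subset
  · have : Nonempty α := ⟨y⟩
    obtain ⟨f, hf⟩ := X.finite_toSet.exists_bijOn_of_encard_eq (t := (Y : Set α))
      (by simp only [Set.encard_coe_eq_coe_finsetCard, hcard])
    exact ⟨f, hf.injOn, fun x hx => ⟨hf.mapsTo hx, h x hx _ (hf.mapsTo hx)⟩⟩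

theorem singleton {x y : α} (h : y ≤ x) : Dominates {x} {y} :=
  of_forall_le rfl (by simpa only [mem_singleton, forall_eq])

variable [DecidableEq α]

theorem union (hX : Dominates X Y) (hX' : Dominates X' Y') (hY : Disjoint Y Y') :
    Dominates (X ∪ X') (Y ∪ Y') := by
  obtain ⟨f, hf, hfY⟩ := hX
  obtain ⟨g, hg, hgY⟩ := hX'
  have hfg : ∀ x ∈ X, ∀ x' ∈ X', f x ≠ g x' := fun x hx x' hx' =>
    disjoint_iff_ne.1 hY _ (hfY x hx).1 _ (hgY x' hx').1
  refine ⟨fun x => if x ∈ X then f x else g x, fun x hx y hy hxy => ?_, fun x hx => ?_⟩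
  · simp only [coe_union, Set.mem_union, mem_coe] at hx hy
    grind [Set.InjOn]
  · grind

theorem insert {x y : α} (h : y ≤ x) (hX : Dominates X Y) (hy : y ∉ Y) :
    Dominates (insert x X) (insert y Y) :=
  (singleton h).union hX (disjoint_singleton_left.2 hy)

theorem pair {x x' y y' : α} (h : y ≤ x) (h' : y' ≤ x') (hy : y ≠ y') :
    Dominates {x, x'} {y, y'} :=
  (singleton h').insert h (by rwa [mem_singleton])

end Dominates

/-- `𝒢` contains, with each of its members `X`, every `Y ⊆ U` that `X` dominates: the members
inside `U` form an up-set closed under shifting. -/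
def DominationClosed (U : Finset α) (𝒢 : Finset (Finset α)) : Prop :=
  ∀ X ∈ 𝒢, ∀ Y ⊆ U, Dominates X Y → Y ∈ 𝒢

end Domination

section UpGenerated

variable {n : ℕ} {F : Finset (Finset ℕ)}

theorem canShift_image {A : Finset ℕ} {f : ℕ → ℕ} (hf : Set.InjOn f A) (hle : ∀ a ∈ A, f a ≤ a) :
    CanShift A (A.image f) := by
  have hcard : #(A.image f) = #A := card_image_of_injOn hf
  refine ⟨hcard, fun i => ?_⟩
  set a := A.orderEmbOfFin rfl
  set b := (A.image f).orderEmbOfFin hcard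
  have ha : ∀ j, a j ∈ A := orderEmbOfFin_mem A rfl
  by_contra! hlt
  -- The `i + 1` distinct values `f (a j)`, `j ≤ i`, would all lie among the `b k` with `k < i`.
  have hsub : (Iic i).image (f ∘ a) ⊆ (Iio i).image b := by
    intro y hy
    obtain ⟨j, hj, rfl⟩ := mem_image.1 hy
    obtain ⟨k, hk⟩ : f (a j) ∈ Set.range b := by
      rw [range_orderEmbOfFin]
      exact mem_image_of_mem f (ha j)
    have hbk : b k < b i :=
      (hk.trans_le ((hle _ (ha j)).trans (a.monotone (mem_Iic.1 hj)))).trans_lt hlt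
    exact mem_image.2 ⟨k, mem_Iio.2 (b.lt_iff_lt.1 hbk), hk⟩
  have hinj : Injective (f ∘ a) := fun j k hjk => a.injective (hf (ha j) (ha k) hjk)
  have hcard_le := card_le_card hsub
  rw [card_image_of_injective _ hinj, card_image_of_injective _ b.injective, Fin.card_Iic,
    Fin.card_Iio] at hcard_le
  exact Nat.not_succ_le_self _ hcard_le

/-- The up-set of `2^[n]` generated by the nonempty members of `F`. The empty set is left out so
that disjoint members are distinct. -/
def upGenerated (n : ℕ) (F : Finset (Finset ℕ)) : Finset (Finset ℕ) :=
  {B ∈ (Icc 1 n).powerset | ∃ C ∈ F, C.Nonempty ∧ C ⊆ B}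

theorem IsShifted.dominationClosed_upGenerated (hF : IsShifted n F) :
    DominationClosed (Icc 1 n) (upGenerated n F) := by
  rintro X hX Y hY ⟨f, hf, hfY⟩
  obtain ⟨-, C, hC, hne, hCX⟩ := mem_filter.1 hX
  have hCY : C.image f ⊆ Y := image_subset_iff.2 fun x hx => (hfY x (hCX hx)).1
  have hshift : CanShift C (C.image f) :=
    canShift_image (hf.mono (coe_subset.2 hCX)) fun x hx => (hfY x (hCX hx)).2
  exact mem_filter.2
    ⟨mem_powerset.2 hY, C.image f, hF C hC _ (hCY.trans hY) hshift, hne.image f, hCY⟩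

theorem card_missingSets_upGenerated_le (n : ℕ) (F : Finset (Finset ℕ)) :
    #(missingSets n (upGenerated n F)) ≤ #(missingSets n F) + 1 := by
  refine (card_le_card fun B hB => ?_).trans (card_insert_le ∅ _)
  obtain ⟨hBn, hB⟩ := mem_sdiff.1 hB
  refine mem_insert.2 (B.eq_empty_or_nonempty.imp_right fun hne => mem_sdiff.2 ⟨hBn, fun hBF => ?_⟩)
  exact hB (mem_filter.2 ⟨hBn, B, hBF, hne, subset_rfl⟩)

theorem ContainsMatching.of_upGenerated {V : Finset ℕ} {r : ℕ}
    (h : ContainsMatching (upGenerated n F) V r) :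
    ContainsMatching {A ∈ F | A.Nonempty} V r :=
  h.of_forall_exists_subset fun A hA => by
    obtain ⟨-, C, hC, hne, hCA⟩ := mem_filter.1 hA
    exact ⟨C, mem_filter.2 ⟨hC, hne⟩, hCA⟩

end UpGenerated

section Splitting

variable {α : Type*} [DecidableEq α] {H T A J : Finset α}

theorem union_inter_eq_left_of_disjoint (hHT : Disjoint H T) (hA : A ⊆ H) (hJ : J ⊆ T) :
    (A ∪ J) ∩ H = A := by
  rw [union_inter_distrib_right, inter_eq_left.2 hA,
    disjoint_iff_inter_eq_empty.1 (hHT.symm.mono_left hJ), union_empty]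

theorem union_inter_eq_right_of_disjoint (hHT : Disjoint H T) (hA : A ⊆ H) (hJ : J ⊆ T) :
    (A ∪ J) ∩ T = J := by
  rw [union_comm, union_inter_eq_left_of_disjoint hHT.symm hJ hA]

theorem card_mul_le_card_of_forall_le_card_filter (hHT : Disjoint H T) {ℬ ℳ : Finset (Finset α)}
    {N : ℕ} (hℬT : ℬ ⊆ T.powerset) (hN : ∀ J ∈ ℬ, N ≤ #{A ∈ H.powerset | A ∪ J ∈ ℳ}) :
    #ℬ * N ≤ #ℳ := by
  have hfibre : ∀ J ∈ ℬ, N ≤ #{M ∈ ℳ | M ∩ T = J} := fun J hJ => by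
    have hJT : J ⊆ T := mem_powerset.1 (hℬT hJ)
    refine (hN J hJ).trans (card_le_card_of_injOn (· ∪ J) (fun A hA => ?_) fun A hA A' hA' h => ?_)
    · obtain ⟨hAH, hAJ⟩ := mem_filter.1 hA
      exact mem_filter.2 ⟨hAJ, union_inter_eq_right_of_disjoint hHT (mem_powerset.1 hAH) hJT⟩
    · rw [← union_inter_eq_left_of_disjoint hHT (mem_powerset.1 (mem_filter.1 hA).1) hJT,
        ← union_inter_eq_left_of_disjoint hHT (mem_powerset.1 (mem_filter.1 hA').1) hJT]
      exact congrArg (· ∩ H) h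
  calc #ℬ * N ≤ ∑ J ∈ ℬ, #{M ∈ ℳ | M ∩ T = J} := card_nsmul_le_sum ℬ _ N hfibre
    _ = #{M ∈ ℳ | M ∩ T ∈ ℬ} := sum_card_fiberwise_eq_card_filter ℳ ℬ (· ∩ T)
    _ ≤ #ℳ := card_filter_le _ _

end Splitting

theorem disjoint_Icc_Ioc (h n : ℕ) : Disjoint (Icc 1 h) (Ioc h n) :=
  disjoint_left.2 fun _ hx hx' => (mem_Ioc.1 hx').1.not_ge (mem_Icc.1 hx).2

theorem Icc_one_union_Ioc {h n : ℕ} (hhn : h ≤ n) : Icc 1 h ∪ Ioc h n = Icc 1 n := by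
  grind

section RichSets

variable {α : Type*} [DecidableEq α] {H T D U V W : Finset α} {𝒢 : Finset (Finset α)}
  {b r s w k R : ℕ}

open Classical in
/-- The rich subsets of `T`: those that can be completed to a member of `𝒢` by a `b`-subset of `H`
avoiding any prescribed set of at most `R` elements. -/
noncomputable def richSets (H T : Finset α) (b R : ℕ) (𝒢 : Finset (Finset α)) :
    Finset (Finset α) :=
  {J ∈ T.powerset | ∀ X : Finset α, #X ≤ R → ∃ A ∈ H.powersetCard b, Disjoint A X ∧ A ∪ J ∈ 𝒢}

theorem mem_richSets {J : Finset α} : J ∈ richSets H T b R 𝒢 ↔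
    J ⊆ T ∧ ∀ X : Finset α, #X ≤ R → ∃ A ∈ H.powersetCard b, Disjoint A X ∧ A ∪ J ∈ 𝒢 := by
  classical simp only [richSets, mem_filter, mem_powerset]

theorem card_powerset_sdiff_richSets_mul_le (hHT : Disjoint H T) (b R : ℕ)
    (𝒢 : Finset (Finset α)) :
    #(T.powerset \ richSets H T b R 𝒢) * (#H - R).choose b ≤ #((H ∪ T).powerset \ 𝒢) := by
  refine card_mul_le_card_of_forall_le_card_filter hHT sdiff_subset fun J hJ => ?_
  obtain ⟨hJT, hJ⟩ := mem_sdiff.1 hJ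
  obtain ⟨X, hX, hXJ⟩ : ∃ X : Finset α, #X ≤ R ∧
      ∀ A ∈ H.powersetCard b, Disjoint A X → A ∪ J ∉ 𝒢 := by
    simpa only [mem_richSets, mem_powerset.1 hJT, true_and, not_forall, exists_prop, not_exists,
      not_and] using hJ
  calc (#H - R).choose b ≤ (#(H \ X)).choose b :=
        Nat.choose_le_choose b (by have := le_card_sdiff X H; lia)
    _ = #((H \ X).powersetCard b) := (card_powersetCard _ _).symm
    _ ≤ _ := card_le_card fun A hA => ?_
  obtain ⟨hAHX, hAb⟩ := mem_powersetCard.1 hA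
  obtain ⟨hAH, hAX⟩ := subset_sdiff.1 hAHX
  exact mem_filter.2 ⟨mem_powerset.2 hAH, mem_sdiff.2
    ⟨mem_powerset.2 (union_subset_union hAH (mem_powerset.1 hJT)),
      hXJ A (mem_powersetCard.2 ⟨hAH, hAb⟩) hAX⟩⟩

theorem DominationClosed.richSets [Preorder α] (hHT : Disjoint H T)
    (h𝒢 : DominationClosed (H ∪ T) 𝒢) : DominationClosed T (richSets H T b R 𝒢) := by
  intro J hJ J' hJ'T hJJ'
  refine mem_richSets.2 ⟨hJ'T, fun X hX => ?_⟩
  obtain ⟨A, hA, hAX, hAJ⟩ := (mem_richSets.1 hJ).2 X hX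
  have hAH : A ⊆ H := (mem_powersetCard.1 hA).1
  exact ⟨A, hA, hAX, h𝒢 _ hAJ _ (union_subset_union hAH hJ'T)
    ((Dominates.of_subset subset_rfl).union hJJ' (disjoint_of_subset_left hAH
      (disjoint_of_subset_right hJ'T hHT)))⟩

theorem ContainsMatching.exists_of_richSets (hHV : Disjoint H V) (hR : #D + r * b ≤ R)
    (h : ContainsMatching (richSets H T b R 𝒢) V r) :
    ∃ W ⊆ H \ D, #W ≤ r * b ∧ ContainsMatching 𝒢 (W ∪ V) r := by
  induction r generalizing V with
  | zero => exact ⟨∅, empty_subset _, by simp, .zero 𝒢 _⟩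
  | succ r ih =>
    rw [Nat.succ_mul] at hR ⊢
    obtain ⟨J, hJ, hJV, hVJ⟩ := h.exists_of_succ
    obtain ⟨W, hWHD, hWcard, hW⟩ := ih (hHV.mono_right sdiff_subset) (by lia) hVJ
    obtain ⟨A, hA, hAX, hAJ⟩ := (mem_richSets.1 hJ).2 (D ∪ W)
      ((card_union_le D W).trans (by lia))
    obtain ⟨hAH, hAb⟩ := mem_powersetCard.1 hA
    obtain ⟨hAD, hAW⟩ := disjoint_union_right.1 hAX
    have hWJ : Disjoint W J := hHV.mono (hWHD.trans sdiff_subset) hJV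
    have hAV : Disjoint A V := hHV.mono_left hAH
    refine ⟨A ∪ W, union_subset (subset_sdiff.2 ⟨hAH, hAD⟩) hWHD,
      (card_union_le A W).trans (by lia), .cons hAJ ?_ (hW.mono ?_)⟩
    · exact union_subset_union subset_union_left hJV
    · exact union_subset (subset_sdiff.2 ⟨subset_union_right.trans subset_union_left,
        disjoint_union_right.2 ⟨hAW.symm, hWJ⟩⟩) (subset_sdiff.2
        ⟨sdiff_subset.trans subset_union_right, disjoint_union_right.2
          ⟨(hAV.mono_right sdiff_subset).symm, sdiff_disjoint⟩⟩)

/-- Every subset of `H` with room for `r ≥ k` disjoint `w`-sets contains `r` disjoint members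
of `𝒢`. -/
def PacksSubsets (𝒢 : Finset (Finset α)) (H : Finset α) (w k : ℕ) : Prop :=
  ∀ U ⊆ H, ∀ r, k ≤ r → w * r ≤ #U → ContainsMatching 𝒢 U r

-- Each of the `r` rich sets takes only `b` elements of `H`, one less than an ordinary member.
theorem PacksSubsets.containsMatching_of_richSets (hpack : PacksSubsets 𝒢 H (b + 1) k)
    (hHV : Disjoint H V) (h : ContainsMatching (richSets H T b R 𝒢) V r) (hR : #D + r * b ≤ R)
    (hs : k + r ≤ s) (hcard : (b + 1) * s ≤ #(H \ D) + r) :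
    ContainsMatching 𝒢 (H \ D ∪ V) s := by
  obtain ⟨W, hWHD, hWcard, hW⟩ := h.exists_of_richSets hHV hR
  obtain ⟨r', rfl⟩ := Nat.exists_eq_add_of_le (le_of_add_le_right hs)
  have hrest : ContainsMatching 𝒢 ((H \ D) \ W) r' := by
    refine hpack _ (sdiff_subset.trans sdiff_subset) r' (by lia) ?_
    rw [card_sdiff_of_subset hWHD]
    lia
  have hdisj : Disjoint (W ∪ V) ((H \ D) \ W) :=
    disjoint_union_left.2 ⟨disjoint_sdiff, (hHV.mono_left (sdiff_subset.trans sdiff_subset)).symm⟩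
  refine (hW.union hdisj hrest).mono ?_
  rw [union_right_comm, union_sdiff_of_subset hWHD]

end RichSets

section Blocks

variable {l h n b : ℕ} {G : Finset (Finset ℕ)}

-- If `A ∪ {u}` is missing, then so is `B ∪ {y}` for every `b`-set `B ⊆ (l, h]` and `y ∈ (h, n]`.
theorem insert_mem_of_card_missingSets_lt (hG : DominationClosed (Icc 1 n) G) (hlh : l ≤ h)
    (hhn : h ≤ n) (hlt : #(missingSets n G) < (n - h) * (h - l).choose b) {A : Finset ℕ} {u : ℕ}
    (hA : A ∈ (Icc 1 l).powersetCard b) (hu : u ∈ Icc 1 h) (huA : u ∉ A) : insert u A ∈ G := by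
  obtain ⟨hAl, hAb⟩ := mem_powersetCard.1 hA
  by_contra hnot
  refine hlt.not_ge ?_
  calc (n - h) * (h - l).choose b
      = #((Ioc h n).powersetCard 1) * #((Ioc l h).powersetCard b) := by
        rw [card_powersetCard, card_powersetCard, Nat.card_Ioc, Nat.card_Ioc, Nat.choose_one_right]
    _ ≤ #(missingSets n G) := card_mul_le_card_of_forall_le_card_filter (disjoint_Icc_Ioc h n)
        (fun Y hY => mem_powerset.2 (mem_powersetCard.1 hY).1)
        fun Y hY => card_le_card fun B hB => ?_
  obtain ⟨hYhn, hY⟩ := mem_powersetCard.1 hY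
  obtain ⟨y, rfl⟩ := card_eq_one.1 hY
  obtain ⟨hBlh, hBb⟩ := mem_powersetCard.1 hB
  have hBh : B ⊆ Icc 1 h := hBlh.trans fun x hx => by grind
  have hdom : Dominates (B ∪ {y}) (insert u A) := by
    rw [union_comm, ← insert_eq]
    exact .insert (by grind) (.of_forall_le (hBb.trans hAb.symm) (by grind)) huA
  refine mem_filter.2 ⟨mem_powerset.2 hBh, mem_sdiff.2 ⟨mem_powerset.2 ?_, fun hmem => hnot ?_⟩⟩
  · rw [← Icc_one_union_Ioc hhn]
    exact union_subset_union hBh hYhn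
  · exact hG _ hmem _ (insert_subset (by grind) (hAl.trans (Icc_subset_Icc_right (by lia)))) hdom

theorem DominationClosed.packsSubsets (hG : DominationClosed (Icc 1 n) G) (hlh : l ≤ h)
    (hhn : h ≤ n) (hlt : #(missingSets n G) < (n - h) * (h - l).choose b) :
    PacksSubsets G (Icc 1 h) (b + 1) (h - l) := by
  intro U hU r hr hUr
  have hUl : #U ≤ #(U ∩ Icc 1 l) + (h - l) := by
    calc #U ≤ #(U ∩ Icc 1 l ∪ Ioc l h) := card_le_card (by grind)
      _ ≤ _ := by simpa only [Nat.card_Ioc] using card_union_le (U ∩ Icc 1 l) (Ioc l h)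
  obtain ⟨L, hL, hLcard⟩ : ∃ L ⊆ U ∩ Icc 1 l, #L = b * r :=
    exists_subset_card_eq (by lia)
  have hLU : L ⊆ U := hL.trans inter_subset_left
  refine (ContainsMatching.of_insert (U := L) (V := U \ L) (b := b) disjoint_sdiff ?_
    hLcard.ge ?_).mono (union_sdiff_of_subset hLU).subset
  · intro A hA v hv
    obtain ⟨hAL, hAb⟩ := mem_powersetCard.1 hA
    obtain ⟨hvU, hvL⟩ := mem_sdiff.1 hv
    exact insert_mem_of_card_missingSets_lt hG hlh hhn hlt
      (mem_powersetCard.2 ⟨hAL.trans (hL.trans inter_subset_right), hAb⟩) (hU hvU)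
      fun hvA => hvL (hAL hvA)
  · rw [card_sdiff_of_subset hLU]
    lia

end Blocks

section Dichotomy

theorem one_add_card_add_card_le_card_powerset_sdiff {α : Type*} [DecidableEq α] {S T : Finset α}
    {𝓡 E : Finset (Finset α)} (hempty : ∅ ∉ 𝓡) (hS : ∀ x ∈ S, x ∈ T ∧ {x} ∉ 𝓡)
    (hE : E ⊆ T.powersetCard 2 \ 𝓡) : 1 + #S + #E ≤ #(T.powerset \ 𝓡) := by
  have hdisj : Disjoint (S.image singleton) E := by
    refine disjoint_left.2 fun J hJS hJE => ?_
    obtain ⟨x, -, rfl⟩ := mem_image.1 hJS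
    exact absurd (mem_powersetCard.1 (mem_sdiff.1 (hE hJE)).1).2 (by simp)
  have hnotMem : ∅ ∉ S.image singleton ∪ E := by
    intro h
    rcases mem_union.1 h with hS' | hE'
    · obtain ⟨x, -, hx⟩ := mem_image.1 hS'
      exact singleton_ne_empty x hx
    · exact absurd (mem_powersetCard.1 (mem_sdiff.1 (hE hE')).1).2 (by simp)
  calc 1 + #S + #E = #(insert ∅ (S.image singleton ∪ E)) := by
        rw [card_insert_of_notMem hnotMem, card_union_of_disjoint hdisj,
          card_image_of_injective S singleton_injective]
        ring
    _ ≤ #(T.powerset \ 𝓡) := card_le_card <| insert_subset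
        (mem_sdiff.2 ⟨empty_mem_powerset T, hempty⟩) <| union_subset
          (image_subset_iff.2 fun x hx => mem_sdiff.2
            ⟨mem_powerset.2 (singleton_subset_iff.2 (hS x hx).1), (hS x hx).2⟩)
          (hE.trans (sdiff_subset_sdiff (fun J hJ => mem_powerset.2 (mem_powersetCard.1 hJ).1)
            subset_rfl))

variable {h n q c r : ℕ} {𝓡 : Finset (Finset ℕ)}

theorem le_one_of_two_pow_succ_le (hpow : 2 ^ (c + 1) ≤ 2 * c + 2) : c ≤ 1 := by
  by_contra! hc
  obtain ⟨d, rfl⟩ := Nat.exists_eq_add_of_le' hc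
  have hd : d < 2 ^ d := Nat.lt_two_pow_self
  rw [Nat.pow_succ, Nat.pow_succ, Nat.pow_succ] at hpow
  lia

theorem DominationClosed.exists_singleton_mem_iff_le (h𝓡 : DominationClosed (Ioc h n) 𝓡)
    (hhn : h ≤ n) : ∃ q, h ≤ q ∧ q ≤ n ∧ ∀ x ∈ Ioc h n, {x} ∈ 𝓡 ↔ x ≤ q := by
  refine ⟨Nat.findGreatest (fun x => x = h ∨ {x} ∈ 𝓡) n, Nat.le_findGreatest hhn (.inl rfl),
    Nat.findGreatest_le n, fun x hx => ?_⟩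
  obtain ⟨hhx, hxn⟩ := mem_Ioc.1 hx
  refine ⟨fun hx𝓡 => Nat.le_findGreatest hxn (.inr hx𝓡), fun hxq => ?_⟩
  rcases Nat.findGreatest_spec (P := fun x => x = h ∨ {x} ∈ 𝓡) hhn (.inl rfl) with hq | hq
  · lia
  · exact h𝓡 _ hq _ (singleton_subset_iff.2 hx) (.singleton hxq)

-- One of the `r` nested pairs `{q + 1 + i, q + 2r - i}` is missing, and it is dominated by each
-- of the `c` pairs `{a, n}` with `q + r ≤ a < n`.
theorem DominationClosed.exists_subset_powersetCard_two_sdiff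
    (h𝓡 : DominationClosed (Ioc h n) 𝓡) (hhq : h ≤ q) (hrc : r ≤ c) (hn : n = q + c + r)
    (hno : ¬ ContainsMatching 𝓡 (Ioc q n) r) : ∃ E ⊆ (Ioc h n).powersetCard 2 \ 𝓡, #E = c := by
  obtain ⟨i, hi⟩ : ∃ i : Fin r, ({q + 1 + i, q + 2 * r - i} : Finset ℕ) ∉ 𝓡 := by
    by_contra! hall
    refine hno ⟨_, fun i => ⟨hall i, fun x => by grind⟩, fun i j hij => ?_⟩
    simp only [onFun, disjoint_left]
    grind
  refine ⟨(Ico (q + r) n).image fun a => {a, n}, ?_, ?_⟩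
  · refine image_subset_iff.2 fun a ha => mem_sdiff.2 ⟨mem_powersetCard.2 ?_, fun hmem => ?_⟩
    · exact ⟨by grind, card_pair (mem_Ico.1 ha).2.ne⟩
    · exact hi (h𝓡 _ hmem _ (by grind) (.pair (by grind) (by grind) (by grind)))
  · rw [card_image_of_injOn fun a _ a' _ haa' => ?_, Nat.card_Ico]
    · lia
    · have : a ∈ ({a', n} : Finset ℕ) := haa' ▸ mem_insert_self a _
      grind

theorem DominationClosed.dichotomy_of_not_containsMatching
    (h𝓡 : DominationClosed (Ioc h n) 𝓡) (hempty : ∅ ∉ 𝓡) (hhq : h ≤ q) (hn : n = q + c + r)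
    (hq : ∀ x ∈ Ioc h n, {x} ∈ 𝓡 ↔ x ≤ q) (hmissing : #((Ioc h n).powerset \ 𝓡) ≤ 2 * c + 2)
    (hfar : ¬ ContainsMatching 𝓡 (Ioc q n) r) :
    r = c + 1 ∧ (Ioc h n).powersetCard 2 ⊆ 𝓡 ∨ r = 1 ∧ c = 1 := by
  have hcount : ∀ E ⊆ (Ioc h n).powersetCard 2 \ 𝓡, 1 + (c + r) + #E ≤ 2 * c + 2 := fun E hE => by
    rw [show c + r = #(Ioc q n) by rw [Nat.card_Ioc]; lia]
    exact (one_add_card_add_card_le_card_powerset_sdiff hempty (by grind) hE).trans hmissing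
  have hle : r ≤ c + 1 := by
    have := hcount ∅ (empty_subset _)
    rw [card_empty] at this
    lia
  rcases hle.lt_or_eq with hlt | rfl
  · have hrc := Nat.lt_succ_iff.1 hlt
    obtain ⟨E, hE, hEcard⟩ := h𝓡.exists_subset_powersetCard_two_sdiff hhq hrc hn hfar
    have hr : r ≠ 0 := fun hr => hfar (hr ▸ .zero 𝓡 _)
    obtain rfl : r = 1 := by have := hcount E hE; lia
    have hpow : #(Ioc q n).powerset ≤ 2 * c + 2 := by
      refine (card_le_card fun J hJ => mem_sdiff.2 ⟨?_, fun hJ𝓡 => hfar ?_⟩).trans hmissing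
      · exact powerset_mono.2 (Ioc_subset_Ioc_left hhq) hJ
      · exact .cons hJ𝓡 (mem_powerset.1 hJ) (.zero 𝓡 _)
    rw [card_powerset, Nat.card_Ioc, show n - q = c + 1 by lia] at hpow
    exact .inr ⟨rfl, hrc.antisymm' (le_one_of_two_pow_succ_le hpow)⟩
  · refine .inl ⟨rfl, fun J hJ => ?_⟩
    by_contra hJ𝓡
    have := hcount {J} (singleton_subset_iff.2 (mem_sdiff.2 ⟨hJ, hJ𝓡⟩))
    rw [card_singleton] at this
    lia

theorem DominationClosed.dichotomy (h𝓡 : DominationClosed (Ioc h n) 𝓡)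
    (hmissing : #((Ioc h n).powerset \ 𝓡) ≤ 2 * c + 2)
    (hno : ¬ ContainsMatching 𝓡 (Ioc h n) (n - h - c)) :
    ∃ q, h ≤ q ∧ (∀ x ∈ Ioc h q, {x} ∈ 𝓡) ∧
      (n = q + (2 * c + 1) ∧ (Ioc h n).powersetCard 2 ⊆ 𝓡 ∨ n = q + 2 ∧ c = 1) := by
  have hhn : h ≤ n := by
    by_contra! hlt
    exact hno (by rw [Nat.sub_eq_zero_of_le hlt.le, Nat.zero_sub]; exact .zero 𝓡 _)
  have hempty : ∅ ∉ 𝓡 := fun hmem => hno <| .of_singletons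
    (fun x hx => h𝓡 ∅ hmem _ (singleton_subset_iff.2 hx) (.of_subset (empty_subset _)))
    (by rw [Nat.card_Ioc]; exact Nat.sub_le _ _)
  obtain ⟨q, hhq, hqn, hq⟩ := h𝓡.exists_singleton_mem_iff_le hhn
  have hsingle : ∀ x ∈ Ioc h q, {x} ∈ 𝓡 := fun x hx => (hq x (by grind)).2 (mem_Ioc.1 hx).2
  have hlt : c < n - q := by
    by_contra! hle
    exact hno ((ContainsMatching.of_singletons hsingle (by rw [Nat.card_Ioc]; lia)).mono
      (Ioc_subset_Ioc_right hqn))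
  obtain ⟨r, hr⟩ : ∃ r, n = q + c + r := Nat.exists_eq_add_of_le (by lia)
  have hfar : ¬ ContainsMatching 𝓡 (Ioc q n) r := fun hfar => by
    have hnear : ContainsMatching 𝓡 (Ioc h q) (q - h) :=
      .of_singletons hsingle (Nat.card_Ioc h q).ge
    have := hnear.union (by grind [disjoint_left]) hfar
    rw [Ioc_union_Ioc_eq_Ioc hhq hqn, show q - h + r = n - h - c by lia] at this
    exact hno this
  refine ⟨q, hhq, hsingle, ?_⟩
  refine (h𝓡.dichotomy_of_not_containsMatching hempty hhq hr hq hmissing hfar).imp ?_ ?_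
  · rintro ⟨rfl, hpairs⟩
    exact ⟨by lia, hpairs⟩
  · rintro ⟨rfl, rfl⟩
    exact ⟨hr, rfl⟩

end Dichotomy

section Core

variable {b c h k l n q r R s : ℕ} {D : Finset ℕ} {F G : Finset (Finset ℕ)}

theorem card_Icc_one_sdiff_add_card_inter (D : Finset ℕ) (q : ℕ) :
    #(Icc 1 q \ D) + #(D ∩ Icc 1 q) = q := by
  rw [inter_comm, card_sdiff_add_card_inter, Nat.card_Icc, Nat.add_sub_cancel]

theorem card_inter_Icc_one_add_card_inter_Ioc (hD : D ⊆ Icc 1 n) (hqn : q ≤ n) :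
    #(D ∩ Icc 1 q) + #(D ∩ Ioc q n) = #D := by
  rw [← card_union_of_disjoint ((disjoint_Icc_Ioc q n).mono inter_subset_right inter_subset_right),
    ← inter_union_distrib_left, Icc_one_union_Ioc hqn, inter_eq_left.2 hD]

theorem PacksSubsets.containsMatching_of_singletons (hpack : PacksSubsets G (Icc 1 h) (b + 1) k)
    (hhq : h ≤ q) (hqn : q ≤ n)
    (hsingle : ∀ x ∈ Ioc h q, {x} ∈ richSets (Icc 1 h) (Ioc h n) b R G)
    (hfar : ContainsMatching (richSets (Icc 1 h) (Ioc h n) b R G) (Ioc q n \ D) r)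
    (hr : r ≤ n - q) (hR : #D + (n - h) * b ≤ R) (hs : k + (n - h) ≤ s)
    (hcard : (b + 1) * s ≤ #(Icc 1 q \ D) + r) : ContainsMatching G (Icc 1 n \ D) s := by
  have hnear : ContainsMatching (richSets (Icc 1 h) (Ioc h n) b R G) (Ioc h q \ D) #(Ioc h q \ D) :=
    .of_singletons (fun x hx => hsingle x (mem_sdiff.1 hx).1) le_rfl
  have hnear_card : #(Ioc h q \ D) ≤ q - h :=
    (card_le_card sdiff_subset).trans (Nat.card_Ioc h q).le
  have hcard_le : #(Icc 1 q \ D) ≤ #(Icc 1 h \ D) + #(Ioc h q \ D) := by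
    rw [← Icc_one_union_Ioc hhq, union_sdiff_distrib]
    exact card_union_le _ _
  have hrich : ContainsMatching (richSets (Icc 1 h) (Ioc h n) b R G) (Ioc h n \ D)
      (#(Ioc h q \ D) + r) := by
    refine (hnear.union ?_ hfar).mono ?_
    · grind [disjoint_left]
    · rw [← union_sdiff_distrib, Ioc_union_Ioc_eq_Ioc hhq hqn]
  have hrich_card : (#(Ioc h q \ D) + r) * b ≤ (n - h) * b := Nat.mul_le_mul_right b (by lia)
  refine (hpack.containsMatching_of_richSets ((disjoint_Icc_Ioc h n).mono_right sdiff_subset)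
    hrich (s := s) (D := D) (by lia) (by lia) (by lia)).mono ?_
  rw [← union_sdiff_distrib, Icc_one_union_Ioc (hhq.trans hqn)]

theorem PacksSubsets.containsMatching_of_notMem_familyQ
    (hpack : PacksSubsets G (Icc 1 h) (b + 1) k) (hn : (b + 1) * (s + 1) + c = n)
    (hhq : h ≤ q) (hqn : n = q + (2 * c + 1))
    (hsingle : ∀ x ∈ Ioc h q, {x} ∈ richSets (Icc 1 h) (Ioc h n) b R G)
    (hpairs : (Ioc h n).powersetCard 2 ⊆ richSets (Icc 1 h) (Ioc h n) b R G)
    (hR : 2 * (b + 1) + (n - h) * b ≤ R) (hs : k + (n - h) ≤ s) (hDn : D ⊆ Icc 1 n)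
    (hD : D ∉ familyQ (b + 1) (s + 1) c) : ContainsMatching G (Icc 1 n \ D) s := by
  have hlight : #D + #(D ∩ Icc 1 q) < 2 * (b + 1) := by
    have hq : (b + 1) * (s + 1) - c - 1 = q := by lia
    simpa only [familyQ, mem_filter, mem_powerset, hn, hDn, true_and, hq, not_le] using hD
  have hDq := card_inter_Icc_one_add_card_inter_Ioc hDn (show q ≤ n by lia)
  have hcompl := card_Icc_one_sdiff_add_card_inter D q
  have hfar_card : #(Ioc q n \ D) + #(D ∩ Ioc q n) = n - q := by
    rw [inter_comm, card_sdiff_add_card_inter, Nat.card_Ioc]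
  have hfar : ContainsMatching (richSets (Icc 1 h) (Ioc h n) b R G) (Ioc q n \ D)
      (#(Ioc q n \ D) / 2) :=
    .of_powersetCard (fun J hJ => hpairs (powersetCard_mono
      (sdiff_subset.trans (Ioc_subset_Ioc_left hhq)) hJ)) (Nat.mul_div_le _ _)
  rw [Nat.mul_succ] at hn
  exact hpack.containsMatching_of_singletons hhq (by lia) hsingle hfar (by lia) (by lia) hs
    (by lia)

theorem PacksSubsets.containsMatching_of_notMem_familyW
    (hpack : PacksSubsets G (Icc 1 h) (b + 1) k) (hn : (b + 1) * (s + 1) + 1 = n)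
    (hhq : h ≤ q) (hqn : n = q + 2)
    (hsingle : ∀ x ∈ Ioc h q, {x} ∈ richSets (Icc 1 h) (Ioc h n) b R G)
    (hR : 2 * (b + 1) + (n - h) * b ≤ R) (hs : k + (n - h) ≤ s) (hDn : D ⊆ Icc 1 n)
    (hD : D ∉ familyW (b + 1) (s + 1) 1) : ContainsMatching G (Icc 1 n \ D) s := by
  have hlight : #(D ∩ Icc 1 q) < b + 1 := by
    have hq : (b + 1) * (s + 1) - 1 = q := by lia
    simpa only [familyW, mem_filter, mem_powerset, hn, hDn, true_and, hq, not_le] using hD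
  have hDq := card_inter_Icc_one_add_card_inter_Ioc hDn (show q ≤ n by lia)
  have hcompl := card_Icc_one_sdiff_add_card_inter D q
  have hfar_card : #(D ∩ Ioc q n) ≤ n - q :=
    (card_le_card inter_subset_right).trans (Nat.card_Ioc q n).le
  rw [Nat.mul_succ] at hn
  exact hpack.containsMatching_of_singletons hhq (by lia) hsingle (.zero _ _) (Nat.zero_le _)
    (by lia) hs (by lia)

theorem IsShifted.two_mul_add_three_le_card_powerset_sdiff_richSets
    (hn : (b + 1) * (s + 1) + c = n) (hF : IsShifted n F) (hFn : F ⊆ (Icc 1 n).powerset)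
    (hν : matchingNumber F ≤ s) (hQ : ¬ F ⊆ familyQ (b + 1) (s + 1) c)
    (hW : c = 1 → ¬ F ⊆ familyW (b + 1) (s + 1) c) (hlh : l ≤ h) (hhn : h ≤ n)
    (hs : n - l ≤ s) (hR : 2 * (b + 1) + (n - h) * b ≤ R)
    (hlt : #(missingSets n (upGenerated n F)) < (n - h) * (h - l).choose b) :
    2 * c + 3 ≤
      #((Ioc h n).powerset \ richSets (Icc 1 h) (Ioc h n) b R (upGenerated n F)) := by
  by_contra! hpoor
  have hG := hF.dominationClosed_upGenerated
  have hpack := hG.packsSubsets hlh hhn hlt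
  have hrich : DominationClosed (Ioc h n) (richSets (Icc 1 h) (Ioc h n) b R (upGenerated n F)) :=
    .richSets (disjoint_Icc_Ioc h n) (by rwa [Icc_one_union_Ioc hhn])
  have hmember : ∀ D ∈ F, ¬ ContainsMatching (upGenerated n F) (Icc 1 n \ D) s := fun D hD hs =>
    (hs.of_upGenerated.lt_matchingNumber hD disjoint_sdiff).not_ge hν
  have hno : ¬ ContainsMatching (richSets (Icc 1 h) (Ioc h n) b R (upGenerated n F)) (Ioc h n)
      (n - h - c) := fun hmatching => by
    have hmul : (n - h - c) * b ≤ (n - h) * b := Nat.mul_le_mul_right b (Nat.sub_le _ _)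
    have := hpack.containsMatching_of_richSets (disjoint_Icc_Ioc h n) hmatching (D := ∅)
      (s := s + 1) (by rw [card_empty]; lia) (by lia) (by rw [sdiff_empty, Nat.card_Icc]; lia)
    exact (this.of_upGenerated.le_matchingNumber).not_gt (by lia)
  obtain ⟨q, hhq, hsingle, ⟨hqn, hpairs⟩ | ⟨hqn, rfl⟩⟩ := hrich.dichotomy (by lia) hno
  · obtain ⟨D, hDF, hDQ⟩ := not_subset.1 hQ
    exact hmember D hDF (hpack.containsMatching_of_notMem_familyQ hn hhq hqn hsingle hpairs hR
      (by lia) (mem_powerset.1 (hFn hDF)) hDQ)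
  · obtain ⟨D, hDF, hDW⟩ := not_subset.1 (hW rfl)
    exact hmember D hDF (hpack.containsMatching_of_notMem_familyW hn hhq hqn hsingle hR
      (by lia) (mem_powerset.1 (hFn hDF)) hDW)

end Core

section BinomialEstimates

variable {a b c d k m n s : ℕ}

theorem choose_succ_le_choose_sub_add (n d b : ℕ) :
    n.choose (b + 1) ≤ (n - d).choose (b + 1) + d * n ^ b := by
  induction d with
  | zero => simp
  | succ d ih =>
    have hstep : (n - d).choose (b + 1) ≤ (n - (d + 1)).choose (b + 1) + n ^ b := by
      rw [← Nat.sub_sub]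
      cases hr : n - d with
      | zero => simp
      | succ r =>
        rw [Nat.add_sub_cancel, Nat.choose_succ_succ', add_comm]
        gcongr
        exact (Nat.choose_le_pow r b).trans (Nat.pow_le_pow_left (by lia) b)
    linarith

theorem mul_add_pow_le (hs : 1 ≤ s) : (m * s + c) ^ b ≤ (m + c) ^ b * s ^ b := by
  rw [← mul_pow, add_mul]
  gcongr
  exact Nat.le_mul_of_pos_right c hs

theorem mul_add_choose_succ_le (hs : 1 ≤ s) :
    (m * s + c).choose (b + 1) ≤
      (m * s + c - d).choose (b + 1) + d * (m + c) ^ b * s ^ b := by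
  refine (choose_succ_le_choose_sub_add _ d b).trans ?_
  rw [mul_assoc]
  gcongr
  exact mul_add_pow_le hs

theorem choose_le_pow_mul_choose (hn : n ≤ a * (k + 1 - b)) :
    n.choose b ≤ a ^ b * k.choose b := by
  refine Nat.le_of_mul_le_mul_left ?_ b.factorial_pos
  calc b.factorial * n.choose b = n.descFactorial b :=
        (Nat.descFactorial_eq_factorial_mul_choose n b).symm
    _ ≤ n ^ b := Nat.descFactorial_le_pow n b
    _ ≤ (a * (k + 1 - b)) ^ b := Nat.pow_le_pow_left hn b
    _ = a ^ b * (k + 1 - b) ^ b := mul_pow _ _ _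
    _ ≤ a ^ b * k.descFactorial b := Nat.mul_le_mul_left _ (Nat.pow_sub_le_descFactorial k b)
    _ = b.factorial * (a ^ b * k.choose b) := by
        rw [Nat.descFactorial_eq_factorial_mul_choose, mul_left_comm]

end BinomialEstimates

section MissingSets

variable {b c n R s t : ℕ} {F : Finset (Finset ℕ)}

theorem IsShifted.mul_choose_le_card_missingSets_add_one
    (hn : (b + 1) * (s + 1) + c = n) (hF : IsShifted n F) (hFn : F ⊆ (Icc 1 n).powerset)
    (hν : matchingNumber F ≤ s) (hQ : ¬ F ⊆ familyQ (b + 1) (s + 1) c)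
    (hW : c = 1 → ¬ F ⊆ familyW (b + 1) (s + 1) c)
    (ht : (2 * c + 3) * (2 * (b + 1 + c)) ^ b ≤ t) (hR : 2 * (b + 1) + t * b ≤ R)
    (hs : 2 * (t + b) ≤ s) :
    (2 * c + 3) * (n - (t + R)).choose b ≤ #(missingSets n F) + 1 := by
  refine le_trans ?_ (card_missingSets_upGenerated_le n F)
  have hsn : s ≤ n := by
    rw [← hn]
    nlinarith
  have hnt : n - (n - t) = t := Nat.sub_sub_self (le_trans (by lia) hsn)
  rcases lt_or_ge #(missingSets n (upGenerated n F)) (t * (s - t).choose b) with hlt | hge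
  · have hpoor := hF.two_mul_add_three_le_card_powerset_sdiff_richSets hn hFn hν hQ hW
      (l := n - s) (h := n - t) (R := R) (by lia) (by lia) (by lia) (by rwa [hnt])
      (by rwa [hnt, show n - t - (n - s) = s - t by lia])
    have hmissing := card_powerset_sdiff_richSets_mul_le (disjoint_Icc_Ioc (n - t) n) b R
      (upGenerated n F)
    rw [Nat.card_Icc, Nat.add_sub_cancel, Nat.sub_sub, Icc_one_union_Ioc (Nat.sub_le n t)]
      at hmissing
    exact (Nat.mul_le_mul_right _ hpoor).trans hmissing
  · have hchoose : n.choose b ≤ (2 * (b + 1 + c)) ^ b * (s - t).choose b := by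
      refine choose_le_pow_mul_choose ?_
      have hlarge : s + 1 ≤ 2 * (s - t + 1 - b) := by lia
      nlinarith
    calc (2 * c + 3) * (n - (t + R)).choose b ≤ (2 * c + 3) * n.choose b := by
          gcongr
          exact Nat.sub_le _ _
      _ ≤ (2 * c + 3) * ((2 * (b + 1 + c)) ^ b * (s - t).choose b) := by gcongr
      _ ≤ t * (s - t).choose b := by
          rw [← mul_assoc]
          gcongr
      _ ≤ _ := hge

theorem exists_mul_choose_sub_le_card_missingSets_add_one (b c : ℕ) :
    ∃ d, ∀ s n F, (b + 2) * (s + 1) + c = n → IsShifted n F → F ⊆ (Icc 1 n).powerset →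
      matchingNumber F ≤ s → ¬ F ⊆ familyQ (b + 2) (s + 1) c →
      (c = 1 → ¬ F ⊆ familyW (b + 2) (s + 1) c) →
      (2 * c + 3) * (n - d).choose (b + 1) ≤ #(missingSets n F) + 1 := by
  set t := (2 * c + 3) * (2 * (b + 1 + 1 + c)) ^ (b + 1) with ht
  set R := 2 * (b + 1 + 1) + t * (b + 1) with hR
  set s₀ := 2 * (t + (b + 1))
  refine ⟨t + R + ((b + 2) * (s₀ + 1) + c), fun s n F hn hF hFn hν hQ hW => ?_⟩
  rcases le_total s s₀ with hs | hs
  -- For small `s` the shift by `d` exhausts `n` and the binomial coefficient vanishes.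
  · have hle : n ≤ (b + 2) * (s₀ + 1) + c := by
      rw [← hn]
      gcongr
    rw [Nat.sub_eq_zero_of_le (by lia), Nat.choose_zero_succ, mul_zero]
    exact Nat.zero_le _
  · refine le_trans ?_
      (hF.mul_choose_le_card_missingSets_add_one hn hFn hν hQ hW ht.ge hR.ge hs)
    exact Nat.mul_le_mul_left _
      (Nat.choose_le_choose _ (Nat.sub_le_sub_left (Nat.le_add_right _ _) n))

theorem exists_mul_choose_le_card_missingSets_add (b c : ℕ) :
    ∃ K : ℕ, ∀ s F, F ⊆ (Icc 1 ((b + 2) * s + c)).powerset → IsShifted ((b + 2) * s + c) F →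
      matchingNumber F < s → ¬ F ⊆ familyQ (b + 2) s c → (c = 1 → ¬ F ⊆ familyW (b + 2) s c) →
      (2 * c + 3) * ((b + 2) * s + c).choose (b + 1) ≤
        #(missingSets ((b + 2) * s + c) F) + K * s ^ b := by
  obtain ⟨d, hd⟩ := exists_mul_choose_sub_le_card_missingSets_add_one b c
  refine ⟨(2 * c + 3) * (d * (b + 2 + c) ^ b) + 1, fun s F hFn hF hν hQ hW => ?_⟩
  obtain ⟨s, rfl⟩ := Nat.exists_eq_add_one_of_ne_zero (Nat.ne_zero_of_lt hν)
  have hmissing := hd s _ F rfl hF hFn (Nat.lt_succ_iff.1 hν) hQ hW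
  have hpow : 1 ≤ (s + 1) ^ b := Nat.one_le_pow _ _ s.succ_pos
  calc (2 * c + 3) * ((b + 2) * (s + 1) + c).choose (b + 1)
      ≤ (2 * c + 3) * (((b + 2) * (s + 1) + c - d).choose (b + 1) +
          d * (b + 2 + c) ^ b * (s + 1) ^ b) := by
        gcongr
        exact mul_add_choose_succ_le s.succ_pos
    _ ≤ _ := by linarith

end MissingSets

section LightSets

variable {α : Type*}

theorem card_powerset_filter_card_le_one (T : Finset α) : #{J ∈ T.powerset | #J ≤ 1} = #T + 1 := by
  classical
  have hunion : {J ∈ T.powerset | #J ≤ 1} = T.powersetCard 0 ∪ T.powersetCard 1 := by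
    ext J
    grind
  rw [hunion, card_union_of_disjoint (pairwise_disjoint_powersetCard T zero_ne_one),
    card_powersetCard, card_powersetCard, Nat.choose_zero_right, Nat.choose_one_right, add_comm]

theorem card_powerset_filter_card_lt_le (H : Finset α) (b : ℕ) :
    #{A ∈ H.powerset | #A < b + 1} ≤ (b + 1) * (#H + 1) ^ b := by
  classical
  have hcover : {A ∈ H.powerset | #A < b + 1} ⊆ (range (b + 1)).biUnion H.powersetCard := by
    intro A hA
    obtain ⟨hAH, hA_card⟩ := mem_filter.1 hA
    exact mem_biUnion.2 ⟨#A, mem_range.2 hA_card, mem_powersetCard.2 ⟨mem_powerset.1 hAH, rfl⟩⟩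
  refine (card_le_card hcover).trans ((card_biUnion_le_card_mul _ _ ((#H + 1) ^ b)
    fun j hj => ?_).trans_eq (by rw [card_range]))
  rw [card_powersetCard]
  calc (#H).choose j ≤ #H ^ j := Nat.choose_le_pow _ _
    _ ≤ (#H + 1) ^ j := Nat.pow_le_pow_left (Nat.le_succ _) _
    _ ≤ (#H + 1) ^ b := Nat.pow_le_pow_right (Nat.succ_pos _) (Nat.lt_succ_iff.1 (mem_range.1 hj))

variable [DecidableEq α] {H T : Finset α}

/-- The subsets of `H ∪ T` of weight less than `2(b + 1)`, where the elements of `H` have weight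
two and those of `T \ H` weight one. They are the complement of a family of the form `Q(m, s, ℓ)`
with `m = b + 1`. -/
def lightSets (H T : Finset α) (b : ℕ) : Finset (Finset α) :=
  {P ∈ (H ∪ T).powerset | #P + #(P ∩ H) < 2 * (b + 1)}

theorem mul_choose_le_card_lightSets (hHT : Disjoint H T) (b : ℕ) :
    (#T + 1) * (#H).choose b ≤ #(lightSets H T b) := by
  rw [← card_powerset_filter_card_le_one, ← card_powersetCard]
  refine card_mul_le_card_of_forall_le_card_filter hHT (filter_subset _ _) fun J hJ => ?_
  obtain ⟨hJT, hJ_card⟩ := mem_filter.1 hJ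
  rw [mem_powerset] at hJT
  refine card_le_card fun A hA => ?_
  obtain ⟨hAH, hA_card⟩ := mem_powersetCard.1 hA
  have hunion := card_union_le A J
  simp only [lightSets, mem_filter, mem_powerset, union_inter_eq_left_of_disjoint hHT hAH hJT]
  exact ⟨hAH, union_subset_union hAH hJT, by lia⟩

theorem card_lightSets_le (hHT : Disjoint H T) (b : ℕ) :
    #(lightSets H T b) ≤ (#T + 1) * (#H).choose b + 2 ^ #T * #{A ∈ H.powerset | #A < b} := by
  have hcover : lightSets H T b ⊆
      image₂ (· ∪ ·) {J ∈ T.powerset | #J ≤ 1} (H.powersetCard b) ∪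
        image₂ (· ∪ ·) T.powerset {A ∈ H.powerset | #A < b} := by
    intro P hP
    obtain ⟨hP, hweight⟩ := mem_filter.1 hP
    have hsplit : P ∩ T ∪ P ∩ H = P := by
      rw [← inter_union_distrib_left, union_comm, inter_eq_left.2 (mem_powerset.1 hP)]
    have hcard : #(P ∩ T) + #(P ∩ H) = #P := by
      rw [← card_union_of_disjoint (hHT.symm.mono inter_subset_right inter_subset_right), hsplit]
    rw [mem_union, mem_image₂, mem_image₂]
    rcases lt_or_ge #(P ∩ H) b with hlt | hge
    · exact .inr ⟨_, mem_powerset.2 inter_subset_right, _,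
        mem_filter.2 ⟨mem_powerset.2 inter_subset_right, hlt⟩, hsplit⟩
    · exact .inl ⟨_, mem_filter.2 ⟨mem_powerset.2 inter_subset_right, by lia⟩, _,
        mem_powersetCard.2 ⟨inter_subset_right, by lia⟩, hsplit⟩
  refine (card_le_card hcover).trans ((card_union_le _ _).trans ?_)
  rw [← card_powerset_filter_card_le_one, ← card_powersetCard, ← card_powerset]
  exact add_le_add (card_image₂_le _ _ _) (card_image₂_le _ _ _)

end LightSets

section FamilyQ

variable {b c s : ℕ}

theorem missingSets_familyQ (b s c : ℕ) :
    missingSets ((b + 1) * s + c) (familyQ (b + 1) s c) =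
      lightSets (Icc 1 ((b + 1) * s + c - (2 * c + 1)))
        (Ioc ((b + 1) * s + c - (2 * c + 1)) ((b + 1) * s + c)) b := by
  have hhead : (b + 1) * s - c - 1 = (b + 1) * s + c - (2 * c + 1) := by lia
  rw [missingSets, familyQ, lightSets, Icc_one_union_Ioc (Nat.sub_le _ _), hhead,
    ← filter_not]
  simp only [not_le]

theorem mul_choose_sub_le_card_missingSets_familyQ (b s c : ℕ) :
    (2 * c + 2) * ((b + 2) * s + c - (2 * c + 1)).choose (b + 1) ≤
      #(missingSets ((b + 2) * s + c) (familyQ (b + 2) s c)) := by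
  rw [missingSets_familyQ]
  rcases le_total ((b + 2) * s + c) (2 * c + 1) with hle | hge
  · simp [Nat.sub_eq_zero_of_le hle]
  · refine le_of_eq_of_le ?_ (mul_choose_le_card_lightSets (disjoint_Icc_Ioc _ _) (b + 1))
    rw [Nat.card_Icc, Nat.card_Ioc, Nat.add_sub_cancel, Nat.sub_sub_self hge]

theorem card_missingSets_familyQ_le (hs : 1 ≤ s) :
    #(missingSets ((b + 2) * s + c) (familyQ (b + 2) s c)) ≤
      (2 * c + 2) * ((b + 2) * s + c).choose (b + 1) +
        2 ^ (2 * c + 1) * ((b + 1) * ((b + 3 + c) ^ b * s ^ b)) := by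
  rw [missingSets_familyQ]
  refine (card_lightSets_le (disjoint_Icc_Ioc _ _) (b + 1)).trans ?_
  have htail : #(Ioc ((b + 2) * s + c - (2 * c + 1)) ((b + 2) * s + c)) ≤ 2 * c + 1 := by
    rw [Nat.card_Ioc]
    lia
  have hhead : #(Icc 1 ((b + 2) * s + c - (2 * c + 1))) ≤ (b + 2) * s + c := by
    rw [Nat.card_Icc]
    lia
  have hfew := card_powerset_filter_card_lt_le (Icc 1 ((b + 2) * s + c - (2 * c + 1))) b
  have hpow : ((b + 2) * s + c + 1) ^ b ≤ (b + 3 + c) ^ b * s ^ b :=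
    (mul_add_pow_le (m := b + 2) (c := c + 1) hs).trans_eq (by ring)
  refine add_le_add (Nat.mul_le_mul (Nat.succ_le_succ htail)
    (Nat.choose_le_choose _ hhead)) (Nat.mul_le_mul (Nat.pow_le_pow_right two_pos htail) ?_)
  refine hfew.trans ?_
  grw [hhead, hpow]

theorem exists_abs_card_missingSets_familyQ_sub_le (b c : ℕ) :
    ∃ K : ℝ, ∀ s : ℕ, 1 ≤ s →
      |(#(missingSets ((b + 2) * s + c) (familyQ (b + 2) s c)) : ℝ) -
          (2 * (c : ℝ) + 2) * ((b + 2) * s + c).choose (b + 1)| ≤ K * (s : ℝ) ^ b := by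
  refine ⟨(2 * c + 2) * ((2 * c + 1) * (b + 2 + c) ^ b) +
    2 ^ (2 * c + 1) * ((b + 1) * (b + 3 + c) ^ b), fun s hs => ?_⟩
  have hlower : (2 * c + 2) * ((b + 2) * s + c).choose (b + 1) ≤
      #(missingSets ((b + 2) * s + c) (familyQ (b + 2) s c)) +
        (2 * c + 2) * ((2 * c + 1) * (b + 2 + c) ^ b * s ^ b) := by
    grw [mul_add_choose_succ_le (d := 2 * c + 1) hs, mul_add,
      mul_choose_sub_le_card_missingSets_familyQ]
  have hupper := card_missingSets_familyQ_le (b := b) (c := c) hs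
  rify at hlower hupper
  have hlower_nonneg : (0 : ℝ) ≤ (2 * c + 2) * ((2 * c + 1) * (b + 2 + c) ^ b * s ^ b) := by
    positivity
  have hupper_nonneg : (0 : ℝ) ≤ 2 ^ (2 * c + 1) * ((b + 1) * ((b + 3 + c) ^ b * s ^ b)) := by
    positivity
  rw [abs_le]
  constructor <;> linarith

end FamilyQ

end

theorem theoremt_general (m c : ℕ) (hm : 2 ≤ m) :
    (∃ K : ℝ, ∀ s : ℕ, ∀ F : Finset (Finset ℕ),
      F ⊆ (Finset.Icc 1 (m * s + c)).powerset →
      IsShifted (m * s + c) F →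
      matchingNumber F < s →
      ¬ F ⊆ familyQ m s c →
      (c = 1 → ¬ F ⊆ familyW m s c) →
      (2 * (c : ℝ) + 3) * ((m * s + c).choose (m - 1) : ℝ) - K * (s : ℝ) ^ (m - 2)
        ≤ ((missingSets (m * s + c) F).card : ℝ)) ∧
    (∃ K : ℝ, ∀ s : ℕ, 1 ≤ s →
      |((missingSets (m * s + c) (familyQ m s c)).card : ℝ)
          - (2 * (c : ℝ) + 2) * ((m * s + c).choose (m - 1) : ℝ)|
        ≤ K * (s : ℝ) ^ (m - 2)) := by
  obtain ⟨b, rfl⟩ := Nat.exists_eq_add_of_le' hm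
  refine ⟨?_, exists_abs_card_missingSets_familyQ_sub_le b c⟩
  obtain ⟨K, hK⟩ := exists_mul_choose_le_card_missingSets_add b c
  refine ⟨K, fun s F hFn hF hν hQ hW => sub_le_iff_le_add.2 ?_⟩
  exact_mod_cast hK s F hFn hF hν hQ hW

theorem theoremt (m c : ℕ) (hm : 2 ≤ m) (hc : 1 ≤ c) :
    (∃ K : ℝ, ∀ s : ℕ, c ≤ s → ∀ F : Finset (Finset ℕ),
      F ⊆ (Finset.Icc 1 (m * s + c)).powerset →
      IsShifted (m * s + c) F →
      matchingNumber F < s →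
      ¬ F ⊆ familyQ m s c →
      (c = 1 → ¬ F ⊆ familyW m s c) →
      (2 * (c : ℝ) + 3) * ((m * s + c).choose (m - 1) : ℝ) - K * (s : ℝ) ^ (m - 2)
        ≤ ((missingSets (m * s + c) F).card : ℝ)) ∧
    (∃ K : ℝ, ∀ s : ℕ, c ≤ s →
      |((missingSets (m * s + c) (familyQ m s c)).card : ℝ)
          - (2 * (c : ℝ) + 2) * ((m * s + c).choose (m - 1) : ℝ)|
        ≤ K * (s : ℝ) ^ (m - 2)) := by
  obtain ⟨⟨K, hK⟩, ⟨K', hK'⟩⟩ := theoremt_general m c hm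
  exact ⟨⟨K, fun s _ => hK s⟩, ⟨K', fun s hs => hK' s (hc.trans hs)⟩⟩
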